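/- Let $M_n(\mathbb C)$ be the algebra of $n\times n$ complex matrices with the Hilbert–Schmidt inner product $\langle A,B\rangle=\mathrm{Tr}\,A^*B$. A function $f:(0,\infty)\to(0,\infty)$ is called a standard matrix monotone function if $f(1)=1$, $x f(x^{-1})=f(x)$ for all $x>0$, and, for all positive definite matrices $X,Y$ of the same (arbitrary) size, $X\le Y$ implies $f(X)\le f(Y)$. For a positive definite $\rho\in M_n(\mathbb C)$ let $\Delta(\rho/\rho)$ be the positive operator $B\mapsto \rho B\rho^{-1}$ on the Hilbert space $M_n(\mathbb C)$, let $f(\Delta(\rho/\rho))$ be given by functional calculus, and for $A,B\in M_n(\mathbb C)$ put $$\mathrm{qCov}^f_\rho(A,B)=\langle A\rho^{1/2}, f(\Delta(\rho/\rho))(B\rho^{1/2})\rangle-(\mathrm{Tr}\,\rho A^*)(\mathrm{Tr}\,\rho B).$$ (The first term equals $\langle A,\mathbb J^f_\rho B\rangle$, where $\mathbb J^f_\rho X=f(\Delta(\rho/\rho))(X\rho)$.) Theorem. Let $f$ be a standard matrix monotone function and let $A\in M_n(\mathbb C)$ be self-adjoint. Then $\mathrm{qCov}^f_\rho(A,A)$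 is real for every positive definite $\rho\in M_n(\mathbb C)$, and $\rho\mapsto\mathrm{qCov}^f_\rho(A,A)$ is a concave function on the set of positive definite matrices of $M_n(\mathbb C)$ (in particular, on the invertible density matrices). -/

import Mathlib

open scoped MatrixOrder ComplexOrder

namespace QuasiEntropy

/-- The Hilbert–Schmidt inner product `⟨A, B⟩ = Tr A* B`. -/
noncomputable def hsInner {n : ℕ} (A B : Matrix (Fin n) (Fin n) ℂ) : ℂ :=
  (A.conjTranspose * B).trace

/-- The (relative) modular operator `Δ(ρ₁/ρ₂) : B ↦ ρ₁ B ρ₂⁻¹`. -/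
noncomputable def modularOp {n : ℕ} (ρ₁ ρ₂ : Matrix (Fin n) (Fin n) ℂ) :
    Matrix (Fin n) (Fin n) ℂ →ₗ[ℂ] Matrix (Fin n) (Fin n) ℂ :=
  LinearMap.mulLeft ℂ ρ₁ ∘ₗ LinearMap.mulRight ℂ ρ₂⁻¹

/-- The matrix of a linear map `T : Mₙ(ℂ) → Mₙ(ℂ)` in the basis of matrix units, which is
orthonormal for the Hilbert–Schmidt inner product. -/
noncomputable def opMatrix {n : ℕ}
    (T : Matrix (Fin n) (Fin n) ℂ →ₗ[ℂ] Matrix (Fin n) (Fin n) ℂ) :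
    Matrix (Fin n × Fin n) (Fin n × Fin n) ℂ :=
  LinearMap.toMatrix (Matrix.stdBasis ℂ (Fin n) (Fin n)) (Matrix.stdBasis ℂ (Fin n) (Fin n)) T

/-- Functional calculus `f(T)` of a linear map `T : Mₙ(ℂ) → Mₙ(ℂ)` that is self-adjoint for the
Hilbert–Schmidt inner product, computed in the orthonormal basis of matrix units. -/
noncomputable def opFun {n : ℕ} (f : ℝ → ℝ)
    (T : Matrix (Fin n) (Fin n) ℂ →ₗ[ℂ] Matrix (Fin n) (Fin n) ℂ) :
    Matrix (Fin n) (Fin n) ℂ →ₗ[ℂ] Matrix (Fin n) (Fin n) ℂ :=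
  Matrix.toLin (Matrix.stdBasis ℂ (Fin n) (Fin n)) (Matrix.stdBasis ℂ (Fin n) (Fin n))
    (cfc f (opMatrix T))

/-- The quasi-entropy `S^A_f(ρ₁‖ρ₂)`, polarized in its upper argument:
`⟨A ρ₂^{1/2}, f(Δ(ρ₁/ρ₂)) (B ρ₂^{1/2})⟩`. -/
noncomputable def quasiEntropy {n : ℕ} (f : ℝ → ℝ) (ρ₁ ρ₂ A B : Matrix (Fin n) (Fin n) ℂ) : ℂ :=
  hsInner (A * CFC.sqrt ρ₂) (opFun f (modularOp ρ₁ ρ₂) (B * CFC.sqrt ρ₂))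

/-- The generalized covariance
`qCov^f_ρ(A, B) = ⟨A ρ^{1/2}, f(Δ(ρ/ρ)) (B ρ^{1/2})⟩ - (Tr ρ A*) (Tr ρ B)`. -/
noncomputable def qCov {n : ℕ} (f : ℝ → ℝ) (ρ A B : Matrix (Fin n) (Fin n) ℂ) : ℂ :=
  quasiEntropy f ρ ρ A B - (ρ * A.conjTranspose).trace * (ρ * B).trace

/-- The operator `𝕁^f_ρ = f(L_ρ R_ρ⁻¹) R_ρ`. -/
noncomputable def opJ {n : ℕ} (f : ℝ → ℝ) (ρ : Matrix (Fin n) (Fin n) ℂ) :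
    Matrix (Fin n) (Fin n) ℂ →ₗ[ℂ] Matrix (Fin n) (Fin n) ℂ :=
  opFun f (modularOp ρ ρ) ∘ₗ LinearMap.mulRight ℂ ρ

/-- A function `f` on `(0, ∞)` is matrix monotone if `A ≤ B` implies `f(A) ≤ f(B)` for positive
definite complex matrices of every size. The values of `f` outside `(0, ∞)` play no role. -/
def IsMatrixMonotone (f : ℝ → ℝ) : Prop :=
  ∀ (m : ℕ) (A B : Matrix (Fin m) (Fin m) ℂ), A.PosDef → B.PosDef → A ≤ B → cfc f A ≤ cfc f B

/-- Standard matrix monotone functions `f : (0, ∞) → (0, ∞)`: matrix monotone, with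
`x f(x⁻¹) = f(x)` and `f(1) = 1`. -/
structure IsStandardMatrixMonotone (f : ℝ → ℝ) : Prop where
  pos : ∀ x : ℝ, 0 < x → 0 < f x
  monotone : IsMatrixMonotone f
  symm : ∀ x : ℝ, 0 < x → x * f x⁻¹ = f x
  map_one : f 1 = 1

lemma opMatrix_mul {n : ℕ} (S T : Matrix (Fin n) (Fin n) ℂ →ₗ[ℂ] Matrix (Fin n) (Fin n) ℂ) :
    opMatrix (S ∘ₗ T) = opMatrix S * opMatrix T :=
  LinearMap.toMatrix_comp _ _ _ S T

lemma opMatrix_modularOp_apply {n : ℕ} (ρ₁ ρ₂ : Matrix (Fin n) (Fin n) ℂ) (i j k l : Fin n) :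
    opMatrix (modularOp ρ₁ ρ₂) (i, j) (k, l) = ρ₁ i k * ρ₂⁻¹ l j := by
  rw [opMatrix, LinearMap.toMatrix_apply, Matrix.stdBasis_eq_single]
  simp [modularOp, Matrix.stdBasis, Matrix.mul_apply, Matrix.single_apply, Finset.sum_ite_eq,
    ite_and]

/-- The modular operator is self-adjoint, so that its functional calculus is the genuine one. -/
lemma isSelfAdjoint_opMatrix_modularOp {n : ℕ} {ρ₁ ρ₂ : Matrix (Fin n) (Fin n) ℂ}
    (h₁ : ρ₁.PosDef) (h₂ : ρ₂.PosDef) : IsSelfAdjoint (opMatrix (modularOp ρ₁ ρ₂)) := by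
  have e₂ := h₂.inv.isHermitian
  ext ⟨i, j⟩ ⟨k, l⟩
  rw [Matrix.star_apply, opMatrix_modularOp_apply, opMatrix_modularOp_apply, star_mul',
    h₁.isHermitian.apply, e₂.apply]

lemma opFun_modularOp_mul {n : ℕ} (f : ℝ → ℝ) {ρ : Matrix (Fin n) (Fin n) ℂ} (hρ : ρ.PosDef)
    (X C : Matrix (Fin n) (Fin n) ℂ) (hC : Commute C ρ) :
    opFun f (modularOp ρ ρ) (X * C) = opFun f (modularOp ρ ρ) X * C := by
  have hC' : C * ρ⁻¹ = ρ⁻¹ * C := by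
    have hu : IsUnit ρ.det := (Matrix.isUnit_iff_isUnit_det ρ).mp hρ.isUnit
    calc C * ρ⁻¹ = ρ⁻¹ * (ρ * C) * ρ⁻¹ := by
          rw [← Matrix.mul_assoc, Matrix.nonsing_inv_mul _ hu, Matrix.one_mul]
      _ = ρ⁻¹ * C := by
          rw [← hC.eq, Matrix.mul_assoc, Matrix.mul_assoc, Matrix.mul_nonsing_inv _ hu,
            Matrix.mul_one]
  have h0 : modularOp ρ ρ ∘ₗ LinearMap.mulRight ℂ C = LinearMap.mulRight ℂ C ∘ₗ modularOp ρ ρ := by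
    ext1 Y
    simp [modularOp, Matrix.mul_assoc, hC']
  have h1 : Commute (opMatrix (modularOp ρ ρ)) (opMatrix (LinearMap.mulRight ℂ C)) := by
    rw [Commute, SemiconjBy, ← opMatrix_mul, ← opMatrix_mul, h0]
  have h2 := (isSelfAdjoint_opMatrix_modularOp hρ hρ).commute_cfc h1 f
  have h3 : opFun f (modularOp ρ ρ) ∘ₗ LinearMap.mulRight ℂ C
      = LinearMap.mulRight ℂ C ∘ₗ opFun f (modularOp ρ ρ) := by
    have hR : LinearMap.mulRight ℂ C = Matrix.toLin (Matrix.stdBasis ℂ (Fin n) (Fin n))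
        (Matrix.stdBasis ℂ (Fin n) (Fin n)) (opMatrix (LinearMap.mulRight ℂ C)) := by
      simp [opMatrix]
    rw [hR, opFun, ← Matrix.toLin_mul, ← Matrix.toLin_mul, h2.eq]
  simpa using LinearMap.congr_fun h3 X

/-- For positive definite `ρ`, `qCov^f_ρ(A, B) = ⟨A, 𝕁^f_ρ B⟩ - (Tr ρ A*) (Tr ρ B)`. -/
theorem qCov_eq_opJ {n : ℕ} (f : ℝ → ℝ) {ρ : Matrix (Fin n) (Fin n) ℂ} (hρ : ρ.PosDef)
    (A B : Matrix (Fin n) (Fin n) ℂ) :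
    qCov f ρ A B = hsInner A (opJ f ρ B) - (ρ * A.conjTranspose).trace * (ρ * B).trace := by
  have hs : CFC.sqrt ρ * CFC.sqrt ρ = ρ := CFC.sqrt_mul_sqrt_self ρ hρ.posSemidef.nonneg
  have hc : Commute (CFC.sqrt ρ) ρ := by
    have : Commute (CFC.sqrt ρ) (CFC.sqrt ρ * CFC.sqrt ρ) :=
      (Commute.refl _).mul_right (Commute.refl _)
    rwa [hs] at this
  have hh : (CFC.sqrt ρ).conjTranspose = CFC.sqrt ρ := (CFC.sqrt_nonneg ρ).isSelfAdjoint
  rw [qCov, quasiEntropy, opFun_modularOp_mul f hρ B _ hc, opJ, LinearMap.comp_apply,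
    LinearMap.mulRight_apply, opFun_modularOp_mul f hρ B ρ (Commute.refl ρ), hsInner, hsInner,
    Matrix.conjTranspose_mul, hh, Matrix.mul_assoc, Matrix.trace_mul_comm]
  simp only [Matrix.mul_assoc, hs]

end QuasiEntropy

/-! For `ρ = aσ + bτ`, the maps `B ↦ √a B ρ^{-1/2} σ^{1/2}` and `B ↦ √b B ρ^{-1/2} τ^{1/2}` together
form an isometry of `Mₙ(ℂ)` into `Mₙ(ℂ) ⊕ Mₙ(ℂ)`. It compresses `Δ(σ/σ) ⊕ Δ(τ/τ)` to `Δ(ρ/ρ)` and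
sends `Aρ^{1/2}` to `(√a Aσ^{1/2}, √b Aτ^{1/2})`. Hansen's inequality `V* f(X) V ≤ f(V* X V)`
(`jensen`, `jensen_two`) thus gives concavity of the quasi-entropy (`quasiEntropy_concave`), and
subtracting the convex function `(Tr ρA)²` preserves it.

Hansen's inequality comes from monotonicity: a pinching bound `X ≤ Z` with `Z V = (1+ε) V (V* X V)`
gives `V* f(X) V ≤ f((1+ε) V* X V)`. Since `f(x)/x` is decreasing, this is at most `(1+ε) f(V* X
V)`; then `ε → 0`. -/

namespace QuasiEntropy

open Matrix Polynomial
open scoped Kronecker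

variable {ι κ κ' : Type*} [Fintype ι] [DecidableEq ι] [Fintype κ] [DecidableEq κ]
  [Fintype κ'] [DecidableEq κ']

/-! ### Functional calculus and intertwiners -/

/-- On matrices, the functional calculus of a given function is polynomial. -/
lemma exists_polynomial_eqOn (f : ℝ → ℝ) {s : Set ℝ} (hs : s.Finite) :
    ∃ p : ℝ[X], s.EqOn f p.eval := by
  refine ⟨Lagrange.interpolate hs.toFinset id f, fun x hx => ?_⟩
  have := Lagrange.eval_interpolate_at_node (s := hs.toFinset) (v := id) (i := x) f
    (Set.injOn_id _) (by simpa using hx)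
  simpa using this.symm

lemma aeval_mul_intertwine {Z : Matrix κ κ ℂ} {Y : Matrix ι ι ℂ} {V : Matrix κ ι ℂ}
    (h : Z * V = V * Y) (p : ℝ[X]) : aeval Z p * V = V * aeval Y p := by
  have hpow : ∀ k : ℕ, Z ^ k * V = V * Y ^ k := by
    intro k
    induction k with
    | zero => simp
    | succ k ih => rw [pow_succ, Matrix.mul_assoc, h, ← Matrix.mul_assoc, ih, Matrix.mul_assoc,
        ← pow_succ]
  rw [aeval_eq_sum_range, aeval_eq_sum_range, Matrix.sum_mul, Matrix.mul_sum]
  exact Finset.sum_congr rfl fun k _ => by rw [Matrix.smul_mul, hpow, Matrix.mul_smul]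

/-- One polynomial interpolates `f` on both spectra, and polynomials respect intertwining; no
continuity of `f` is needed. -/
lemma cfc_mul_intertwine (f : ℝ → ℝ) {Z : Matrix κ κ ℂ} {Y : Matrix ι ι ℂ} {V : Matrix κ ι ℂ}
    (hZ : Z.IsHermitian) (hY : Y.IsHermitian) (h : Z * V = V * Y) :
    cfc f Z * V = V * cfc f Y := by
  obtain ⟨p, hp⟩ := exists_polynomial_eqOn f
    (Z.finite_real_spectrum.union Y.finite_real_spectrum)
  have eZ : cfc f Z = aeval Z p :=
    (cfc_congr (hp.mono Set.subset_union_left)).trans (cfc_polynomial p Z hZ)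
  have eY : cfc f Y = aeval Y p :=
    (cfc_congr (hp.mono Set.subset_union_right)).trans (cfc_polynomial p Y hY)
  rw [eZ, eY, aeval_mul_intertwine h]

lemma isHermitian_cfc (f : ℝ → ℝ) (Z : Matrix κ κ ℂ) : (cfc f Z).IsHermitian :=
  cfc_predicate f Z

lemma cfc_submatrix_equiv (f : ℝ → ℝ) {Z : Matrix κ κ ℂ} (hZ : Z.IsHermitian) (e : ι ≃ κ) :
    cfc f (Z.submatrix e e) = (cfc f Z).submatrix e e := by
  -- The intertwiner is the permutation matrix of `e`.
  have h := cfc_mul_intertwine f (Z := Z.submatrix e e) (Y := Z)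
    (V := (1 : Matrix κ κ ℂ).submatrix e id) (hZ.submatrix e) hZ (by
      ext i j
      rw [Matrix.mul_apply, ← e.symm.sum_comp]
      simp [Matrix.mul_apply, Matrix.one_apply])
  ext i j
  have := congrFun (congrFun h i) (e j)
  rw [Matrix.mul_apply, ← e.symm.sum_comp] at this
  simpa [Matrix.mul_apply, Matrix.one_apply] using this

lemma IsMatrixMonotone.cfc_le {f : ℝ → ℝ} (hf : IsMatrixMonotone f) {X Z : Matrix κ κ ℂ}
    (hX : X.PosDef) (hZ : Z.PosDef) (h : X ≤ Z) : cfc f X ≤ cfc f Z := by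
  have e := (Fintype.equivFin κ).symm
  have := hf _ (X.submatrix e e) (Z.submatrix e e) (hX.submatrix e.injective)
    (hZ.submatrix e.injective) (by
      rw [Matrix.le_iff] at h ⊢
      exact h.submatrix e)
  rw [cfc_submatrix_equiv f hX.isHermitian, cfc_submatrix_equiv f hZ.isHermitian,
    Matrix.le_iff] at this
  rw [Matrix.le_iff]
  exact (Matrix.posSemidef_submatrix_equiv e).mp this

/-! ### Scalar consequences of monotonicity and symmetry -/

lemma IsStandardMatrixMonotone.monotoneOn {f : ℝ → ℝ} (hf : IsStandardMatrixMonotone f) {x y : ℝ}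
    (hx : 0 < x) (hxy : x ≤ y) : f x ≤ f y := by
  have key : ∀ z : ℝ, cfc f (algebraMap ℝ (Matrix (Fin 1) (Fin 1) ℂ) z) =
      algebraMap ℝ (Matrix (Fin 1) (Fin 1) ℂ) (f z) := fun z => cfc_algebraMap z f
  have pd : ∀ z : ℝ, 0 < z → (algebraMap ℝ (Matrix (Fin 1) (Fin 1) ℂ) z).PosDef := by
    intro z hz
    rw [Matrix.algebraMap_eq_diagonal]
    exact Matrix.PosDef.diagonal fun i => by simpa using hz
  have le : ∀ z w : ℝ, algebraMap ℝ (Matrix (Fin 1) (Fin 1) ℂ) z ≤ algebraMap ℝ _ w ↔ z ≤ w := by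
    intro z w
    rw [Matrix.le_iff, ← map_sub, Matrix.algebraMap_eq_diagonal, Matrix.posSemidef_diagonal_iff]
    simp [-Complex.ofReal_sub]
  have := hf.monotone 1 _ _ (pd x hx) (pd y (hx.trans_le hxy)) ((le x y).mpr hxy)
  rwa [key, key, le] at this

/-- The symmetry `x f(x⁻¹) = f(x)` makes `f(x) / x` decreasing. -/
lemma IsStandardMatrixMonotone.map_mul_le {f : ℝ → ℝ} (hf : IsStandardMatrixMonotone f) {c x : ℝ}
    (hc : 1 ≤ c) (hx : 0 < x) : f (c * x) ≤ c * f x := by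
  have hc0 : 0 < c := zero_lt_one.trans_le hc
  rw [← hf.symm x hx, ← hf.symm (c * x) (mul_pos hc0 hx), mul_assoc]
  have : f (c * x)⁻¹ ≤ f x⁻¹ :=
    hf.monotoneOn (by positivity) (inv_anti₀ hx (le_mul_of_one_le_left hx.le hc))
  gcongr

lemma IsStandardMatrixMonotone.cfc_smul_le {f : ℝ → ℝ} (hf : IsStandardMatrixMonotone f)
    {Y : Matrix ι ι ℂ} (hY : Y.PosDef) {c : ℝ} (hc : 1 ≤ c) :
    cfc f (c • Y) ≤ c • cfc f Y := by
  have hsa : IsSelfAdjoint Y := hY.isHermitian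
  rw [← cfc_comp_smul c f Y ((Y.finite_real_spectrum.image _).continuousOn _) hsa,
    ← cfc_smul c f Y (Y.finite_real_spectrum.continuousOn _)]
  refine cfc_mono (fun x hx => ?_) (Y.finite_real_spectrum.continuousOn _)
    (Y.finite_real_spectrum.continuousOn _)
  rw [hY.isHermitian.spectrum_real_eq_range_eigenvalues] at hx
  obtain ⟨i, rfl⟩ := hx
  exact hf.map_mul_le hc (hY.eigenvalues_pos i)

/-! ### Hansen's inequality -/

lemma mulVec_injective_of_isometry {m : Type*} [Fintype m] {V : Matrix m ι ℂ} (hV : Vᴴ * V = 1) :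
    Function.Injective V.mulVec := by
  intro x y hxy
  have := congrArg (Vᴴ *ᵥ ·) hxy
  simpa [Matrix.mulVec_mulVec, hV] using this

/-- Pinching-type bound of `X` by a matrix commuting with the projection `V V*`. -/
lemma le_smul_compress_add {X : Matrix κ κ ℂ} (hX : X.PosSemidef) {P Q : Matrix κ κ ℂ}
    (hP : P.IsHermitian) (hQ : Q.IsHermitian) (hPQ : P + Q = 1) {ε : ℝ} (hε : 0 < ε) :
    X ≤ (1 + ε) • (P * X * P) + (1 + ε⁻¹) • (Q * X * Q) := by
  -- Positivity of `(sP - s⁻¹Q) X (sP - s⁻¹Q)` bounds the cross terms `PXQ + QXP` by `ε PXP + ε⁻¹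
  -- QXQ`.
  set s := Real.sqrt ε with hs
  have hs0 : 0 < s := Real.sqrt_pos.mpr hε
  have hss : s * s = ε := Real.mul_self_sqrt hε.le
  have e1 : (s • P - s⁻¹ • Q)ᴴ = s • P - s⁻¹ • Q := by
    simp [Matrix.conjTranspose_sub, Matrix.conjTranspose_smul, hP.eq, hQ.eq]
  have e2 : X = (P + Q) * X * (P + Q) := by simp [hPQ]
  have hpsd := hX.conjTranspose_mul_mul_same (s • P - s⁻¹ • Q)
  rw [e1] at hpsd
  rw [Matrix.le_iff]
  suffices h : (1 + ε) • (P * X * P) + (1 + ε⁻¹) • (Q * X * Q) - X =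
      (s • P - s⁻¹ • Q) * X * (s • P - s⁻¹ • Q) from h ▸ hpsd
  nth_rewrite 3 [e2]
  have hi : s⁻¹ * s⁻¹ = ε⁻¹ := by rw [← hss, mul_inv]
  have h1 : s * s⁻¹ = 1 := mul_inv_cancel₀ hs0.ne'
  have h2 : s⁻¹ * s = 1 := inv_mul_cancel₀ hs0.ne'
  simp only [sub_mul, mul_sub, add_mul, mul_add, Matrix.smul_mul, Matrix.mul_smul, smul_smul,
    h1, h2, hi, hss, add_smul, one_smul]
  abel

/-- Hansen's inequality up to a factor `1 + ε`. -/
lemma IsStandardMatrixMonotone.compress_cfc_le {f : ℝ → ℝ} (hf : IsStandardMatrixMonotone f)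
    {X : Matrix κ κ ℂ} (hX : X.PosDef) {V : Matrix κ ι ℂ} (hV : Vᴴ * V = 1) {ε : ℝ} (hε : 0 < ε) :
    Vᴴ * cfc f X * V ≤ (1 + ε) • cfc f (Vᴴ * X * V) := by
  set P := V * Vᴴ with hPdef
  set Q := 1 - P with hQdef
  have hP : P.IsHermitian := Matrix.isHermitian_mul_conjTranspose_self V
  have hQ : Q.IsHermitian := Matrix.isHermitian_one.sub hP
  have hPV : P * V = V := by rw [hPdef, Matrix.mul_assoc, hV, Matrix.mul_one]
  have hQV : Q * V = 0 := by rw [hQdef, Matrix.sub_mul, hPV, Matrix.one_mul, sub_self]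
  set Z := (1 + ε) • (P * X * P) + (1 + ε⁻¹) • (Q * X * Q) with hZdef
  have hXZ : X ≤ Z := le_smul_compress_add hX.posSemidef hP hQ (by simp [hQdef]) hε
  have hZ : Z.PosDef := by
    have := hX.add_posSemidef (Matrix.le_iff.mp hXZ)
    rwa [add_sub_cancel] at this
  have hY : (Vᴴ * X * V).PosDef := hX.conjTranspose_mul_mul_same (mulVec_injective_of_isometry hV)
  have hcY : ((1 + ε) • (Vᴴ * X * V)).IsHermitian := by
    rw [Matrix.IsHermitian, Matrix.conjTranspose_smul, hY.isHermitian.eq, star_trivial]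
  -- The large coefficient `1 + ε⁻¹` disappears here because `Q V = 0`.
  have hZV : Z * V = V * ((1 + ε) • (Vᴴ * X * V)) := by
    rw [hZdef, Matrix.add_mul, Matrix.smul_mul, Matrix.smul_mul, Matrix.mul_assoc (Q * X), hQV,
      Matrix.mul_zero, smul_zero, add_zero, Matrix.mul_assoc (P * X), hPV, hPdef, Matrix.mul_smul]
    simp only [Matrix.mul_assoc]
  have h1 : Vᴴ * cfc f X * V ≤ Vᴴ * cfc f Z * V := by
    have h0 := hf.monotone.cfc_le hX hZ hXZ
    rw [Matrix.le_iff] at h0 ⊢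
    simpa [Matrix.mul_sub, Matrix.sub_mul] using h0.conjTranspose_mul_mul_same V
  rw [Matrix.mul_assoc _ (cfc f Z), cfc_mul_intertwine f hZ.isHermitian hcY hZV,
    ← Matrix.mul_assoc, hV, Matrix.one_mul] at h1
  exact h1.trans (hf.cfc_smul_le hY (by linarith))

/-- Hansen's inequality `V* f(X) V ≤ f(V* X V)` for an isometry `V`. -/
lemma IsStandardMatrixMonotone.jensen {f : ℝ → ℝ} (hf : IsStandardMatrixMonotone f)
    {X : Matrix κ κ ℂ} (hX : X.PosDef) {V : Matrix κ ι ℂ} (hV : Vᴴ * V = 1) (v : ι → ℂ) :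
    (star v ⬝ᵥ (Vᴴ * cfc f X * V) *ᵥ v).re ≤ (star v ⬝ᵥ cfc f (Vᴴ * X * V) *ᵥ v).re := by
  set a := (star v ⬝ᵥ (Vᴴ * cfc f X * V) *ᵥ v).re
  set b := (star v ⬝ᵥ cfc f (Vᴴ * X * V) *ᵥ v).re with hb
  have h : ∀ ε : ℝ, 0 < ε → a ≤ (1 + ε) * b := by
    intro ε hε
    have := (Matrix.le_iff.mp (hf.compress_cfc_le hX hV hε)).re_dotProduct_nonneg v
    simp only [Matrix.sub_mulVec, Matrix.smul_mulVec, dotProduct_sub, dotProduct_smul,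
      RCLike.re_to_complex, Complex.sub_re, Complex.smul_re, smul_eq_mul] at this
    linarith
  have hlim : Filter.Tendsto (fun ε : ℝ => (1 + ε) * b) (nhdsWithin 0 (Set.Ioi 0)) (nhds b) := by
    have : Filter.Tendsto (fun ε : ℝ => (1 + ε) * b) (nhds 0) (nhds ((1 + 0) * b)) :=
      Continuous.tendsto (by fun_prop) 0
    rw [add_zero, one_mul] at this
    exact this.mono_left nhdsWithin_le_nhds
  exact ge_of_tendsto hlim (Filter.eventually_of_mem self_mem_nhdsWithin h)

/-! ### Direct sums and the two-term inequality -/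

lemma posDef_fromBlocks_diagonal {m m' : Type*} [Fintype m] [Fintype m'] {X : Matrix m m ℂ}
    {X' : Matrix m' m' ℂ} (hX : X.PosDef) (hX' : X'.PosDef) : (Matrix.fromBlocks X 0 0 X').PosDef := by
  refine .of_dotProduct_mulVec_pos
    (Matrix.IsHermitian.fromBlocks hX.isHermitian (by simp) hX'.isHermitian) fun x hx => ?_
  obtain ⟨u, w, rfl⟩ : ∃ u w, x = Sum.elim u w := ⟨x ∘ Sum.inl, x ∘ Sum.inr, by simp⟩
  have e : star (Sum.elim u w) = Sum.elim (star u) (star w) := by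
    ext i; cases i <;> rfl
  simp only [Matrix.fromBlocks_mulVec, Matrix.zero_mulVec, add_zero, zero_add, e,
    Sum.elim_comp_inl, Sum.elim_comp_inr, sumElim_dotProduct_sumElim]
  have hu := hX.posSemidef.dotProduct_mulVec_nonneg u
  have hw := hX'.posSemidef.dotProduct_mulVec_nonneg w
  by_cases h : u = 0
  · have hw0 : w ≠ 0 := by
      rintro rfl
      exact hx (by ext i; cases i <;> simp [h])
    exact add_pos_of_nonneg_of_pos hu (hX'.dotProduct_mulVec_pos hw0)
  · exact add_pos_of_pos_of_nonneg (hX.dotProduct_mulVec_pos h) hw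

/-- The two coordinate inclusions intertwine the summands with the block matrix, which determines
both block columns. -/
lemma cfc_fromBlocks_diagonal (f : ℝ → ℝ) {X : Matrix κ κ ℂ} {X' : Matrix κ' κ' ℂ}
    (hX : X.IsHermitian) (hX' : X'.IsHermitian) :
    cfc f (Matrix.fromBlocks X 0 0 X') = Matrix.fromBlocks (cfc f X) 0 0 (cfc f X') := by
  have hB : (Matrix.fromBlocks X 0 0 X').IsHermitian :=
    Matrix.IsHermitian.fromBlocks hX (by simp) hX'
  have h1 := cfc_mul_intertwine f (V := Matrix.fromRows (1 : Matrix κ κ ℂ) (0 : Matrix κ' κ ℂ))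
    hB hX (by simp [Matrix.fromBlocks_mul_fromRows, Matrix.fromRows_mul])
  have h2 := cfc_mul_intertwine f (V := Matrix.fromRows (0 : Matrix κ κ' ℂ) (1 : Matrix κ' κ' ℂ))
    hB hX' (by simp [Matrix.fromBlocks_mul_fromRows, Matrix.fromRows_mul])
  rw [← Matrix.fromBlocks_toBlocks (cfc f (Matrix.fromBlocks X 0 0 X')),
    Matrix.fromBlocks_mul_fromRows, Matrix.fromRows_mul, Matrix.fromRows_inj.eq_iff] at h1 h2
  simp only [Matrix.mul_one, Matrix.mul_zero, Matrix.one_mul, Matrix.zero_mul, add_zero,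
    zero_add] at h1 h2
  rw [← Matrix.fromBlocks_toBlocks (cfc f (Matrix.fromBlocks X 0 0 X')), h1.1, h1.2, h2.1, h2.2]

/-- Stacking `V` over `V'` gives a single isometry, to which `jensen` applies with `X ⊕ X'`. -/
lemma IsStandardMatrixMonotone.jensen_two {f : ℝ → ℝ} (hf : IsStandardMatrixMonotone f)
    {X : Matrix κ κ ℂ} {X' : Matrix κ' κ' ℂ} (hX : X.PosDef) (hX' : X'.PosDef)
    {V : Matrix κ ι ℂ} {V' : Matrix κ' ι ℂ} (hV : Vᴴ * V + V'ᴴ * V' = 1) (v : ι → ℂ) :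
    (star (V *ᵥ v) ⬝ᵥ cfc f X *ᵥ (V *ᵥ v)).re + (star (V' *ᵥ v) ⬝ᵥ cfc f X' *ᵥ (V' *ᵥ v)).re ≤
      (star v ⬝ᵥ cfc f (Vᴴ * X * V + V'ᴴ * X' * V') *ᵥ v).re := by
  have h := hf.jensen (posDef_fromBlocks_diagonal hX hX') (V := Matrix.fromRows V V')
    (by rw [Matrix.conjTranspose_fromRows_eq_fromCols_conjTranspose, Matrix.fromCols_mul_fromRows,
      hV]) v
  rw [cfc_fromBlocks_diagonal f hX.isHermitian hX'.isHermitian,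
    Matrix.conjTranspose_fromRows_eq_fromCols_conjTranspose] at h
  simp only [Matrix.fromCols_mul_fromBlocks, Matrix.fromCols_mul_fromRows, Matrix.mul_zero,
    add_zero, zero_add, Matrix.add_mulVec, dotProduct_add, Complex.add_re] at h
  simpa only [Matrix.star_mulVec, Matrix.dotProduct_mulVec, Matrix.vecMul_vecMul,
    Matrix.mul_assoc] using h

/-! ### Quasi-entropies in matrix-unit coordinates -/

/-- The coordinates of a matrix in the basis of matrix units. -/
def coords {n : ℕ} (A : Matrix (Fin n) (Fin n) ℂ) : Fin n × Fin n → ℂ := fun i => A i.1 i.2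

lemma coords_mul {n : ℕ} (A C : Matrix (Fin n) (Fin n) ℂ) :
    coords (A * C) = ((1 : Matrix (Fin n) (Fin n) ℂ) ⊗ₖ Cᵀ) *ᵥ coords A := by
  ext ⟨i, j⟩
  simp [coords, Matrix.mulVec, dotProduct, Matrix.mul_apply, Fintype.sum_prod_type,
    Matrix.kroneckerMap_apply, Matrix.one_apply, mul_comm]

lemma opMatrix_modularOp {n : ℕ} (ρ₁ ρ₂ : Matrix (Fin n) (Fin n) ℂ) :
    opMatrix (modularOp ρ₁ ρ₂) = ρ₁ ⊗ₖ (ρ₂⁻¹)ᵀ := by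
  ext ⟨i, j⟩ ⟨k, l⟩
  rw [opMatrix_modularOp_apply]
  rfl

lemma quasiEntropy_eq_dotProduct {n : ℕ} (f : ℝ → ℝ) (ρ₁ ρ₂ A B : Matrix (Fin n) (Fin n) ℂ) :
    quasiEntropy f ρ₁ ρ₂ A B = star (coords (A * CFC.sqrt ρ₂)) ⬝ᵥ
      cfc f (ρ₁ ⊗ₖ (ρ₂⁻¹)ᵀ) *ᵥ coords (B * CFC.sqrt ρ₂) := by
  have key : ∀ (M : Matrix (Fin n × Fin n) (Fin n × Fin n) ℂ) (X Y : Matrix (Fin n) (Fin n) ℂ),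
      hsInner X (Matrix.toLin (Matrix.stdBasis ℂ (Fin n) (Fin n))
        (Matrix.stdBasis ℂ (Fin n) (Fin n)) M Y) = star (coords X) ⬝ᵥ M *ᵥ coords Y := by
    intro M X Y
    have hr : ∀ (Z : Matrix (Fin n) (Fin n) ℂ),
        ((Matrix.stdBasis ℂ (Fin n) (Fin n)).repr Z : Fin n × Fin n → ℂ) = coords Z := by
      intro Z
      ext ⟨i, j⟩
      simp [Matrix.stdBasis, coords]
    have hc : coords (Matrix.toLin (Matrix.stdBasis ℂ (Fin n) (Fin n))
        (Matrix.stdBasis ℂ (Fin n) (Fin n)) M Y) = M *ᵥ coords Y := by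
      rw [← hr, ← hr, Matrix.repr_toLin]
    rw [← hc]
    simp only [hsInner, Matrix.trace, Matrix.diag, Matrix.mul_apply, coords, dotProduct,
      Fintype.sum_prod_type, Matrix.conjTranspose_apply, Pi.star_apply]
    exact Finset.sum_comm
  rw [quasiEntropy, opFun, key, opMatrix_modularOp]

lemma quasiEntropy_self_im {n : ℕ} (f : ℝ → ℝ) (ρ₁ ρ₂ A : Matrix (Fin n) (Fin n) ℂ) :
    (quasiEntropy f ρ₁ ρ₂ A A).im = 0 := by
  rw [quasiEntropy_eq_dotProduct]
  exact (isHermitian_cfc f _).im_star_dotProduct_mulVec_self _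

lemma posDef_modular {n : ℕ} {ρ σ : Matrix (Fin n) (Fin n) ℂ} (hρ : ρ.PosDef) (hσ : σ.PosDef) :
    (ρ ⊗ₖ (σ⁻¹)ᵀ).PosDef :=
  hρ.kronecker hσ.inv.transpose

lemma sqrt_isHermitian {n : ℕ} (ρ : Matrix (Fin n) (Fin n) ℂ) : (CFC.sqrt ρ).IsHermitian :=
  (CFC.sqrt_nonneg ρ).isSelfAdjoint

lemma isUnit_det_sqrt {n : ℕ} {ρ : Matrix (Fin n) (Fin n) ℂ} (hρ : ρ.PosDef) :
    IsUnit (CFC.sqrt ρ).det := by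
  have hs : CFC.sqrt ρ * CFC.sqrt ρ = ρ := CFC.sqrt_mul_sqrt_self ρ hρ.posSemidef.nonneg
  have hu : IsUnit ρ.det := (Matrix.isUnit_iff_isUnit_det ρ).mp hρ.isUnit
  rw [← hs, Matrix.det_mul] at hu
  exact isUnit_of_mul_isUnit_left hu

/-- Lieb-type concavity: `ρ ↦ S^A_f(ρ‖ρ)` is concave. -/
theorem IsStandardMatrixMonotone.quasiEntropy_concave {f : ℝ → ℝ}
    (hf : IsStandardMatrixMonotone f) {n : ℕ} (A : Matrix (Fin n) (Fin n) ℂ)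
    {σ τ : Matrix (Fin n) (Fin n) ℂ} (hσ : σ.PosDef) (hτ : τ.PosDef) {a b : ℝ} (ha : 0 ≤ a)
    (hb : 0 ≤ b) (hρ : (a • σ + b • τ).PosDef) :
    a * (quasiEntropy f σ σ A A).re + b * (quasiEntropy f τ τ A A).re ≤
      (quasiEntropy f (a • σ + b • τ) (a • σ + b • τ) A A).re := by
  set ρ := a • σ + b • τ with hρdef
  set S := CFC.sqrt ρ with hS
  have hSS : S * S = ρ := CFC.sqrt_mul_sqrt_self ρ hρ.posSemidef.nonneg
  have hSu : IsUnit S.det := isUnit_det_sqrt hρ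
  have hSh : S⁻¹ᴴ = S⁻¹ := by rw [Matrix.conjTranspose_nonsing_inv, (sqrt_isHermitian ρ).eq]
  have hSi : S⁻¹ * S⁻¹ = ρ⁻¹ := by rw [← hSS, Matrix.mul_inv_rev]
  -- In coordinates, `V t ω` is the map `B ↦ √t B S⁻¹ ω^{1/2}`.
  set V : ℝ → Matrix (Fin n) (Fin n) ℂ → Matrix (Fin n × Fin n) (Fin n × Fin n) ℂ :=
    fun t ω => Real.sqrt t • ((1 : Matrix (Fin n) (Fin n) ℂ) ⊗ₖ (S⁻¹ * CFC.sqrt ω)ᵀ) with hVdef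
  have hVc : ∀ t ω, (V t ω)ᴴ =
      Real.sqrt t • ((1 : Matrix (Fin n) (Fin n) ℂ) ⊗ₖ (CFC.sqrt ω * S⁻¹)ᵀ) := by
    intro t ω
    simp only [hVdef, Matrix.conjTranspose_smul, star_trivial, Matrix.conjTranspose_kronecker,
      Matrix.conjTranspose_one]
    rw [show ∀ M : Matrix (Fin n) (Fin n) ℂ, Mᵀᴴ = Mᴴᵀ from fun _ => rfl, Matrix.conjTranspose_mul,
      (sqrt_isHermitian ω).eq, hSh]
  have hVV : ∀ t ω, 0 ≤ t → ω.PosDef →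
      (V t ω)ᴴ * V t ω = (1 : Matrix (Fin n) (Fin n) ℂ) ⊗ₖ (S⁻¹ * (t • ω) * S⁻¹)ᵀ := by
    intro t ω ht hω
    have hs : CFC.sqrt ω * CFC.sqrt ω = ω := CFC.sqrt_mul_sqrt_self ω hω.posSemidef.nonneg
    have : S⁻¹ * CFC.sqrt ω * (CFC.sqrt ω * S⁻¹) = S⁻¹ * ω * S⁻¹ := by
      rw [Matrix.mul_assoc, ← Matrix.mul_assoc (CFC.sqrt ω), hs, Matrix.mul_assoc]
    rw [hVc]
    simp only [hVdef, Matrix.smul_mul, Matrix.mul_smul, smul_smul, Real.mul_self_sqrt ht,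
      ← Matrix.mul_kronecker_mul, ← Matrix.transpose_mul, this, Matrix.one_mul,
      Matrix.transpose_smul, Matrix.kronecker_smul]
  -- Since `ω^{1/2} ω⁻¹ ω^{1/2} = 1`, the right factor becomes `ρ⁻¹` for every `ω`, so the two
  -- compressions add up to `Δ(ρ/ρ)`.
  have hVXV : ∀ t ω, 0 ≤ t → ω.PosDef →
      (V t ω)ᴴ * (ω ⊗ₖ (ω⁻¹)ᵀ) * V t ω = (t • ω) ⊗ₖ (ρ⁻¹)ᵀ := by
    intro t ω ht hω
    have hs : CFC.sqrt ω * CFC.sqrt ω = ω := CFC.sqrt_mul_sqrt_self ω hω.posSemidef.nonneg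
    have hu := isUnit_det_sqrt hω
    have : S⁻¹ * CFC.sqrt ω * (ω⁻¹ * (CFC.sqrt ω * S⁻¹)) = ρ⁻¹ := by
      have e : CFC.sqrt ω * ω⁻¹ * CFC.sqrt ω = 1 := by
        nth_rewrite 2 [← hs]
        rw [Matrix.mul_inv_rev, ← Matrix.mul_assoc, Matrix.mul_nonsing_inv _ hu, Matrix.one_mul,
          Matrix.nonsing_inv_mul _ hu]
      calc _ = S⁻¹ * (CFC.sqrt ω * ω⁻¹ * CFC.sqrt ω) * S⁻¹ := by simp only [Matrix.mul_assoc]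
        _ = ρ⁻¹ := by rw [e, Matrix.mul_one, hSi]
    rw [hVc]
    simp only [hVdef, Matrix.smul_mul, Matrix.mul_smul, smul_smul, Real.mul_self_sqrt ht,
      ← Matrix.mul_kronecker_mul, ← Matrix.transpose_mul, this, Matrix.one_mul, Matrix.mul_one,
      Matrix.smul_kronecker]
  have hVv : ∀ t ω, V t ω *ᵥ coords (A * S) = Real.sqrt t • coords (A * CFC.sqrt ω) := by
    intro t ω
    simp only [hVdef, Matrix.smul_mulVec, ← coords_mul]
    rw [Matrix.mul_assoc, ← Matrix.mul_assoc S, Matrix.mul_nonsing_inv _ hSu, Matrix.one_mul]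
  have hiso : (V a σ)ᴴ * V a σ + (V b τ)ᴴ * V b τ = 1 := by
    rw [hVV a σ ha hσ, hVV b τ hb hτ, ← Matrix.kronecker_add, ← Matrix.transpose_add,
      ← Matrix.add_mul, ← Matrix.mul_add, ← hρdef, ← hSS, ← Matrix.mul_assoc,
      Matrix.nonsing_inv_mul _ hSu, Matrix.one_mul, Matrix.mul_nonsing_inv _ hSu,
      Matrix.transpose_one, Matrix.one_kronecker_one]
  have h := hf.jensen_two (posDef_modular hσ hσ) (posDef_modular hτ hτ) hiso (coords (A * S))
  rw [hVXV a σ ha hσ, hVXV b τ hb hτ, ← Matrix.add_kronecker, ← hρdef, hVv, hVv] at h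
  have hq : ∀ (t : ℝ) (M : Matrix (Fin n × Fin n) (Fin n × Fin n) ℂ) (v : Fin n × Fin n → ℂ),
      0 ≤ t → (star (Real.sqrt t • v) ⬝ᵥ M *ᵥ (Real.sqrt t • v)).re =
        t * (star v ⬝ᵥ M *ᵥ v).re := by
    intro t M v ht
    rw [star_smul, star_trivial, Matrix.mulVec_smul, dotProduct_smul, smul_dotProduct, smul_smul,
      Real.mul_self_sqrt ht, Complex.smul_re, smul_eq_mul]
  rw [hq _ _ _ ha, hq _ _ _ hb] at h
  simpa only [quasiEntropy_eq_dotProduct] using h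

/-! ### The covariance -/

lemma trace_mul_im_eq_zero {n : ℕ} {ρ A : Matrix (Fin n) (Fin n) ℂ} (hρ : ρ.IsHermitian)
    (hA : A.IsHermitian) : (ρ * A).trace.im = 0 := by
  have : star (ρ * A).trace = (ρ * A).trace := by
    rw [← Matrix.trace_conjTranspose, Matrix.conjTranspose_mul, hρ.eq, hA.eq,
      Matrix.trace_mul_comm]
  exact Complex.conj_eq_iff_im.mp this

end QuasiEntropy

theorem mainTheorem6 (f : ℝ → ℝ) (hf : QuasiEntropy.IsStandardMatrixMonotone f) (n : ℕ)
    (A : Matrix (Fin n) (Fin n) ℂ) (hA : A.IsHermitian) :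
    (∀ ρ : Matrix (Fin n) (Fin n) ℂ, ρ.PosDef → (QuasiEntropy.qCov f ρ A A).im = 0) ∧
    ConcaveOn ℝ {ρ : Matrix (Fin n) (Fin n) ℂ | ρ.PosDef}
      (fun ρ => (QuasiEntropy.qCov f ρ A A).re) := by
  have hconv : ∀ ⦃σ : Matrix (Fin n) (Fin n) ℂ⦄, σ.PosDef → ∀ ⦃τ : Matrix (Fin n) (Fin n) ℂ⦄,
      τ.PosDef → ∀ ⦃a b : ℝ⦄, 0 ≤ a → 0 ≤ b → a + b = 1 → (a • σ + b • τ).PosDef := by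
    intro σ hσ τ hτ a b ha hb hab
    -- Strict positivity needs a nonzero weight: `σ` supplies it unless `a = 0`, when `b = 1`.
    rcases ha.eq_or_lt with rfl | ha'
    · obtain rfl : b = 1 := by linarith
      simpa using hτ
    · exact (hσ.smul ha').add_posSemidef (hτ.posSemidef.smul hb)
  have hre : ∀ ρ : Matrix (Fin n) (Fin n) ℂ, ρ.PosDef → (QuasiEntropy.qCov f ρ A A).re =
      (QuasiEntropy.quasiEntropy f ρ ρ A A).re - (ρ * A).trace.re ^ 2 := by
    intro ρ hρ
    simp [QuasiEntropy.qCov, hA.eq, QuasiEntropy.trace_mul_im_eq_zero hρ.isHermitian hA, sq]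
  refine ⟨fun ρ hρ => ?_, hconv, ?_⟩
  · simp [QuasiEntropy.qCov, hA.eq, QuasiEntropy.trace_mul_im_eq_zero hρ.isHermitian hA,
      QuasiEntropy.quasiEntropy_self_im]
  · intro σ hσ τ hτ a b ha hb hab
    have hρ := hconv hσ hτ ha hb hab
    have h := hf.quasiEntropy_concave A hσ hτ ha hb hρ
    have ht : ((a • σ + b • τ) * A).trace.re = a * (σ * A).trace.re + b * (τ * A).trace.re := by
      simp [Matrix.add_mul]
    simp only [smul_eq_mul]
    rw [hre _ hσ, hre _ hτ, hre _ hρ, ht]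
    obtain rfl : b = 1 - a := by linarith
    -- The convexity gap of the square is `ab (Tr σA - Tr τA)²`.
    nlinarith [mul_nonneg (mul_nonneg ha hb) (sq_nonneg ((σ * A).trace.re - (τ * A).trace.re))]
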